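/- **Setting.** Let $\mathcal X\subset\mathbb R^n$ and $\mathcal Y\subset\mathbb R$ be bounded and let $\mu$ be a probability distribution of pairs $(x,y)$ with $x\in\mathcal X$ and, almost surely, $y\in\mathcal Y$. Denote by $\mu_{\mathcal X}$ the marginal distribution of $x$ and by $\mathbb E(y\mid x)$ the mean of the conditional distribution $\mu(y\mid x)$, which is determined up to a $\mu_{\mathcal X}$-null set of points $x$. Let $\mathcal H$ be a real reproducing kernel Hilbert space of functions $\mathcal X\to\mathbb R$ whose kernel $K:\mathcal X\times\mathcal X\to\mathbb R$ is measurable and bounded on the diagonal, $\sup_{x}K(x,x)<\infty$. For a data set $Z=(x_i,y_i)_{i=1,\dots,N}$ and $\lambda>0$ let $$f_{Z,\lambda}:=\operatorname*{argmin}_{f\in\mathcal H}\ \frac1N\sum_{i=1}^N\bigl(f(x_i)-y_i\bigr)^2+\lambda\|f\|_{\mathcal H}^2 .$$ **Theorem 1.** Suppose that some $f\in\mathcal H$ satisfies $f(x)=\mathbb E(y\mid x)$ for $\mu_{\mathcal X}$-almost every $x$, and let $f_{\mathbb E}$ be the one of least $\mathcal H$-norm among all such $f$ (it is the only one if no nonzero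 element of $\mathcal H$ vanishes $\mu_{\mathcal X}$-almost everywhere). Let $(x_1,y_1),(x_2,y_2),\dots$ be independent with distribution $\mu$, let $Z_N=(x_i,y_i)_{i=1,\dots,N}$, and let $\lambda_N>0$ be such that $\lambda_N\to0$ and $N\lambda_N^3\to\infty$ as $N\to\infty$. Then for every $N\ge1$ the minimizer $f_{Z,\lambda_N}$ exists and is unique for every data set $Z$ of $N$ pairs $(x_i,y_i)\in\mathcal X\times\mathbb R$, and $$\|f_{Z_N,\lambda_N}-f_{\mathbb E}\|_{\mathcal H}\longrightarrow0\quad\text{in probability as }N\to\infty .$$ -/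

import Mathlib

open MeasureTheory ProbabilityTheory Filter Topology

noncomputable section

/-- The scalar reproducing kernel `K(x, x')` of a real RKHS `H` of functions `X → ℝ`. -/
def reproducingKernel (H : Type*) {X : Type*} [NormedAddCommGroup H] [InnerProductSpace ℝ H]
    [CompleteSpace H] [RKHS ℝ H X ℝ] (x x' : X) : ℝ :=
  RKHS.kernel H x x' 1

/-- The regularized empirical risk
`L_{Z,λ}(f) = (1/N) ∑ᵢ (f(xᵢ) - yᵢ)² + λ ‖f‖²` of a data set `z` of `N` pairs `(xᵢ, yᵢ)`. -/
def regularizedRisk {H X : Type*} [NormedAddCommGroup H] [InnerProductSpace ℝ H]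
    [RKHS ℝ H X ℝ] {N : ℕ} (z : Fin N → X × ℝ) (lam : ℝ) (f : H) : ℝ :=
  (1 / (N : ℝ)) * ∑ i, (f (z i).1 - (z i).2) ^ 2 + lam * ‖f‖ ^ 2

/-- `f` is an output of regularized least squares regression on the data set `z` with
regularization parameter `lam`: it minimizes the regularized empirical risk over all of `H`. -/
def IsRLSMinimizer {H X : Type*} [NormedAddCommGroup H] [InnerProductSpace ℝ H]
    [RKHS ℝ H X ℝ] {N : ℕ} (z : Fin N → X × ℝ) (lam : ℝ) (f : H) : Prop :=
  ∀ g : H, regularizedRisk z lam f ≤ regularizedRisk z lam g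

/-- `x ↦ E(y | x)`, the mean of the conditional distribution `μ(y | x)`. It is determined by `μ`
up to a null set of the marginal distribution `μ.fst` of `x`. -/
def regressionFunction {X : Type*} [MeasurableSpace X] (μ : Measure (X × ℝ)) [IsFiniteMeasure μ]
    (x : X) : ℝ :=
  ∫ y, y ∂(μ.condKernel x)

end

/-!
Write `z = (x, y)` and `k x = K(·, x) ∈ H`. The minimizer `f` is characterized by its normal
equation (`IsRLSMinimizer.normal_equation`), which has a unique solution by Lax–Milgram.
Testing that equation with `d = f - fE` gives

  `(1/N) ∑ d(xᵢ)² + lam ‖d‖² = ⟪A, d⟫ - lam ⟪fE, d⟫`,  `A = (1/N) ∑ (yᵢ - fE(xᵢ)) k(xᵢ)`.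

Since `fE` has least norm, it is orthogonal to the null space of the integral operator
`h ↦ ∫ h(x) k(x)`, hence it can be approximated by `m = ∫ h(x) k(x)` for some `h ∈ H`
(`exists_weak_integral_near`). In `⟪fE, d⟫` replace `fE` by `m`, and `m` by the sample mean
`(1/N) ∑ h(xᵢ) k(xᵢ)`; the resulting term `(lam/N) ∑ h(xᵢ) d(xᵢ)` is absorbed by the first term
on the left at the cost of `O(lam²)`. This is the deterministic bound
`IsRLSMinimizer.norm_sub_sq_le`:

  `‖d‖² ≤ 3 (‖A‖² / lam² + ‖(1/N) ∑ h(xᵢ) k(xᵢ) - m‖² + ‖fE - m‖²) + O(lam)`.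

Both sample means have variance `O(1/N)` (`integral_norm_sq_sample_mean_le`), so the expectation of
the right-hand side tends to `3 ‖fE - m‖²`, which is as small as desired, as soon as `lam → 0` and
`N lam² → ∞`; Markov's inequality concludes.

`H` is not assumed separable, so `x ↦ k x` may fail to be strongly measurable. All integrals with
values in `H` are therefore weak ones, given by the Riesz representation theorem
(`exists_weak_integral`), and the second moments are computed from the jointly measurable Gram
functions alone. Similarly, `‖d‖` is not known to be measurable, so Markov's inequality is applied
to its measurable majorant.
-/

section

open scoped RealInnerProductSpace

/-! ### A weak law of large numbers in a possibly non-separable Hilbert space -/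

section WeakLaw

variable {H : Type*} [NormedAddCommGroup H] [InnerProductSpace ℝ H]

lemma norm_sq_smul_sum {N : ℕ} (c : ℝ) (v : Fin N → H) :
    ‖c • ∑ i, v i‖ ^ 2 = c ^ 2 * ∑ i, ∑ j, ⟪v i, v j⟫ := by
  rw [norm_smul, mul_pow, ← real_inner_self_eq_norm_sq (∑ i, v i), sum_inner]
  simp_rw [inner_sum]
  simp

/-- If `V` is bounded and weakly centred and its Gram function `(s, t) ↦ ⟪V s, V t⟫` is
measurable, then the mean of `N` independent copies of `V` has second moment at most `C² / N`.
Only scalar functions are integrated, so `V` need not be strongly measurable. -/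
theorem integral_norm_sq_sample_mean_le {S : Type*} [MeasurableSpace S] {ν : Measure S}
    [IsProbabilityMeasure ν] {V : S → H}
    (hmeas : Measurable fun p : S × S => ⟪V p.1, V p.2⟫) {C : ℝ}
    (hC : ∀ᵐ s ∂ν, ‖V s‖ ≤ C) (hcent : ∀ s, ∫ t, ⟪V s, V t⟫ ∂ν = 0)
    {Ω : Type*} [MeasurableSpace Ω] {P : Measure Ω} [IsProbabilityMeasure P]
    {Z : ℕ → Ω → S} (hZlaw : ∀ i, HasLaw (Z i) ν P) (hZindep : iIndepFun Z P)
    {N : ℕ} (hN : 0 < N) :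
    Integrable (fun ω => ‖(N : ℝ)⁻¹ • ∑ i : Fin N, V (Z i ω)‖ ^ 2) P ∧
      ∫ ω, ‖(N : ℝ)⁻¹ • ∑ i : Fin N, V (Z i ω)‖ ^ 2 ∂P ≤ C ^ 2 / N := by
  have hZm : ∀ i, AEMeasurable (Z i) P := fun i => (hZlaw i).aemeasurable
  have hbd : ∀ i, ∀ᵐ ω ∂P, ‖V (Z i ω)‖ ≤ C := fun i =>
    ae_of_ae_map (hZm i) (by rw [(hZlaw i).map_eq]; exact hC)
  have hbd2 : ∀ i j, ∀ᵐ ω ∂P, ‖⟪V (Z i ω), V (Z j ω)⟫‖ ≤ C ^ 2 := by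
    intro i j
    filter_upwards [hbd i, hbd j] with ω h1 h2
    calc ‖⟪V (Z i ω), V (Z j ω)⟫‖ ≤ ‖V (Z i ω)‖ * ‖V (Z j ω)‖ := norm_inner_le_norm _ _
      _ ≤ C * C := mul_le_mul h1 h2 (norm_nonneg _) ((norm_nonneg _).trans h1)
      _ = C ^ 2 := (sq C).symm
  have hint : ∀ i j, Integrable (fun ω => ⟪V (Z i ω), V (Z j ω)⟫) P := fun i j =>
    Integrable.of_bound
      (hmeas.comp_aemeasurable ((hZm i).prodMk (hZm j))).aestronglyMeasurable _ (hbd2 i j)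
  have hdiag : ∀ i, ∫ ω, ⟪V (Z i ω), V (Z i ω)⟫ ∂P ≤ C ^ 2 := by
    intro i
    calc ∫ ω, ⟪V (Z i ω), V (Z i ω)⟫ ∂P ≤ ∫ _, C ^ 2 ∂P := by
          refine integral_mono_ae (hint i i) (integrable_const _) ?_
          filter_upwards [hbd2 i i] with ω h using (Real.le_norm_self _).trans h
      _ = C ^ 2 := by simp
  have hoff : ∀ i j, i ≠ j → ∫ ω, ⟪V (Z i ω), V (Z j ω)⟫ ∂P = 0 := by
    intro i j hij
    have hmap : P.map (fun ω => (Z i ω, Z j ω)) = ν.prod ν := by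
      rw [(indepFun_iff_map_prod_eq_prod_map_map (hZm i) (hZm j)).1 (hZindep.indepFun hij),
        (hZlaw i).map_eq, (hZlaw j).map_eq]
    have hprod : Integrable (fun p : S × S => ⟪V p.1, V p.2⟫) (ν.prod ν) := by
      rw [← hmap, integrable_map_measure hmeas.aestronglyMeasurable ((hZm i).prodMk (hZm j))]
      exact hint i j
    rw [← integral_map (f := fun p : S × S => ⟪V p.1, V p.2⟫) ((hZm i).prodMk (hZm j))
      hmeas.aestronglyMeasurable, hmap, integral_prod _ hprod]
    simp [hcent]
  simp_rw [norm_sq_smul_sum]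
  have hsum : ∀ i : Fin N, Integrable (fun ω => ∑ j : Fin N, ⟪V (Z i ω), V (Z j ω)⟫) P :=
    fun i => integrable_finsetSum _ fun (j : Fin N) _ => hint i j
  refine ⟨(integrable_finsetSum _ fun i _ => hsum i).const_mul _, ?_⟩
  rw [integral_const_mul, integral_finsetSum _ fun i _ => hsum i]
  have hrow : ∀ i : Fin N, ∫ ω, ∑ j : Fin N, ⟪V (Z i ω), V (Z j ω)⟫ ∂P ≤ C ^ 2 := by
    intro i
    rw [integral_finsetSum _ fun (j : Fin N) _ => hint i j, Finset.sum_eq_single i]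
    · exact hdiag i
    · intro j _ hj
      exact hoff i j fun h => hj (Fin.ext h.symm)
    · simp
  have hN' : (0 : ℝ) < N := by exact_mod_cast hN
  calc ((N : ℝ)⁻¹) ^ 2 * ∑ i : Fin N, ∫ ω, ∑ j : Fin N, ⟪V (Z i ω), V (Z j ω)⟫ ∂P
      ≤ ((N : ℝ)⁻¹) ^ 2 * ∑ _i : Fin N, C ^ 2 := by
        gcongr with i
        exact hrow i
    _ = C ^ 2 / N := by
        simp only [Finset.sum_const, Finset.card_univ, Fintype.card_fin, nsmul_eq_mul]
        field_simp

end WeakLaw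

/-! ### Evaluation, measurability and boundedness in the RKHS -/

section Kernel

variable {H X : Type*} [NormedAddCommGroup H] [InnerProductSpace ℝ H] [CompleteSpace H]
  [RKHS ℝ H X ℝ]

variable (H) in
/-- The section `K(·, x)` of the kernel, as an element of `H`: the Riesz representative of
evaluation at `x`. -/
noncomputable def kernelSection (x : X) : H := RKHS.kerFun H x 1

@[simp]
lemma inner_kernelSection (x : X) (f : H) : ⟪kernelSection H x, f⟫ = f x := by
  simp [kernelSection]

lemma kernelSection_apply (x x' : X) : kernelSection H x' x = reproducingKernel H x x' :=
  RKHS.kerFun_apply H x' 1 x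

lemma norm_kernelSection_sq (x : X) : ‖kernelSection H x‖ ^ 2 = reproducingKernel H x x := by
  rw [← real_inner_self_eq_norm_sq, inner_kernelSection, kernelSection_apply]

lemma norm_kernelSection_le {κ : ℝ} (hK : ∀ x : X, reproducingKernel H x x ≤ κ) (x : X) :
    ‖kernelSection H x‖ ≤ √κ :=
  Real.le_sqrt_of_sq_le ((norm_kernelSection_sq x).trans_le (hK x))

lemma abs_apply_le {κ : ℝ} (hK : ∀ x : X, reproducingKernel H x x ≤ κ) (f : H) (x : X) :
    |f x| ≤ √κ * ‖f‖ := by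
  rw [← inner_kernelSection]
  exact (abs_real_inner_le_norm _ _).trans (by gcongr; exact norm_kernelSection_le hK x)

/-- Every element of an RKHS with a measurable kernel is a measurable function, being a pointwise
limit of linear combinations of kernel sections. -/
lemma measurable_coe [MeasurableSpace X]
    (hKmeas : Measurable fun p : X × X => reproducingKernel H p.1 p.2) (f : H) :
    Measurable (f : X → ℝ) := by
  have hf : f ∈ (Submodule.span ℝ {RKHS.kerFun H x v | (x : X) (v : ℝ)}).topologicalClosure := by
    rw [RKHS.kerFun_dense]; trivial
  obtain ⟨u, hu, hlim⟩ := mem_closure_iff_seq_limit.1 hf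
  refine measurable_of_tendsto_metrizable (f := fun n => (u n : X → ℝ)) (fun n => ?_)
    (tendsto_pi_nhds.2 fun x => ((RKHS.continuous_eval x).tendsto f).comp hlim)
  have hun : u n ∈ Submodule.span ℝ {RKHS.kerFun H x v | (x : X) (v : ℝ)} := hu n
  generalize u n = w at hun ⊢
  induction hun using Submodule.span_induction with
  | mem g hg =>
    obtain ⟨x, v, rfl⟩ := hg
    have hv : RKHS.kerFun H x v = v • kernelSection H x := by
      rw [kernelSection, ← map_smul, smul_eq_mul, mul_one]
    rw [hv, RKHS.coe_smul]
    refine Measurable.const_smul ?_ v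
    have : (kernelSection H x : X → ℝ) = fun x' => reproducingKernel H x' x :=
      funext fun x' => kernelSection_apply x' x
    rw [this]
    exact hKmeas.comp (f := fun x' : X => (x', x)) (by fun_prop)
  | zero => rw [RKHS.coe_zero]; exact measurable_zero
  | add g g' _ _ h h' =>
    rw [RKHS.coe_add]
    exact h.add h'
  | smul a g _ h =>
    rw [RKHS.coe_smul]
    exact h.const_smul a

/-- The weak integral `∫ φ(x) K(·, x) dμ(x)`: for an almost surely bounded `φ` it exists in `H`,
by the Riesz representation theorem. -/
lemma exists_weak_integral [MeasurableSpace X]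
    (hKmeas : Measurable fun p : X × X => reproducingKernel H p.1 p.2) {κ : ℝ}
    (hK : ∀ x : X, reproducingKernel H x x ≤ κ) {μ : Measure X} [IsProbabilityMeasure μ]
    {φ : X → ℝ} (hφ : Measurable φ) {M : ℝ} (hM : ∀ᵐ x ∂μ, |φ x| ≤ M) :
    ∃ m : H, ∀ f : H, ⟪m, f⟫ = ∫ x, φ x * f x ∂μ := by
  have hbd : ∀ f : H, ∀ᵐ x ∂μ, ‖φ x * f x‖ ≤ M * √κ * ‖f‖ := by
    intro f
    filter_upwards [hM] with x hx
    rw [norm_mul, mul_assoc]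
    exact mul_le_mul hx (abs_apply_le hK f x) (norm_nonneg _) ((abs_nonneg _).trans hx)
  have hint : ∀ f : H, Integrable (fun x => φ x * f x) μ := fun f =>
    Integrable.of_bound (hφ.mul (measurable_coe hKmeas f)).aestronglyMeasurable _ (hbd f)
  let L : H →ₗ[ℝ] ℝ :=
    { toFun := fun f => ∫ x, φ x * f x ∂μ
      map_add' := fun f g => by
        rw [← integral_add (hint f) (hint g)]
        simp [mul_add]
      map_smul' := fun c f => by
        rw [RingHom.id_apply, smul_eq_mul, ← integral_const_mul]
        congr 1 with x
        simp only [RKHS.coe_smul, Pi.smul_apply, smul_eq_mul]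
        ring }
  have hL : ∀ f, ‖L f‖ ≤ M * √κ * ‖f‖ := fun f =>
    (norm_integral_le_of_norm_le_const (hbd f)).trans_eq (by simp)
  refine ⟨(InnerProductSpace.toDual ℝ H).symm (L.mkContinuous _ hL), fun f => ?_⟩
  rw [InnerProductSpace.toDual_symm_apply]
  rfl

/-- The weak law of large numbers for the weighted kernel sections `φ(z) K(·, x)`,
`z = (x, y)`, and their weak integral `m`. -/
lemma exists_sample_mean_bound [MeasurableSpace X]
    (hKmeas : Measurable fun p : X × X => reproducingKernel H p.1 p.2) {κ : ℝ}
    (hK : ∀ x : X, reproducingKernel H x x ≤ κ) {μ : Measure (X × ℝ)} [IsProbabilityMeasure μ]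
    {φ : X × ℝ → ℝ} (hφ : Measurable φ) {M : ℝ} (hM : ∀ᵐ z ∂μ, |φ z| ≤ M) {m : H}
    (hm : ∀ f : H, ⟪m, f⟫ = ∫ z, φ z * f z.1 ∂μ)
    {Ω : Type*} [MeasurableSpace Ω] {P : Measure Ω} [IsProbabilityMeasure P]
    {Z : ℕ → Ω → X × ℝ} (hZlaw : ∀ i, HasLaw (Z i) μ P) (hZindep : iIndepFun Z P) :
    ∃ C : ℝ, ∀ N : ℕ, 0 < N →
      Integrable (fun ω => ‖(N : ℝ)⁻¹ • ∑ i : Fin N,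
        (φ (Z i ω) • kernelSection H (Z i ω).1 - m)‖ ^ 2) P ∧
      ∫ ω, ‖(N : ℝ)⁻¹ • ∑ i : Fin N,
        (φ (Z i ω) • kernelSection H (Z i ω).1 - m)‖ ^ 2 ∂P ≤ C / N := by
  have hinner : ∀ (z : X × ℝ) (v : H),
      ⟪v, φ z • kernelSection H z.1 - m⟫ = φ z * v z.1 - ⟪v, m⟫ := by
    intro z v
    rw [inner_sub_right, inner_smul_right, real_inner_comm, inner_kernelSection]
  have hmeasm : Measurable (m : X → ℝ) := measurable_coe hKmeas m
  refine ⟨(M * √κ + ‖m‖) ^ 2, fun N hN => integral_norm_sq_sample_mean_le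
    (V := fun z => φ z • kernelSection H z.1 - m) ?_ ?_ ?_ hZlaw hZindep hN⟩
  · have : (fun p : (X × ℝ) × (X × ℝ) => ⟪φ p.1 • kernelSection H p.1.1 - m,
        φ p.2 • kernelSection H p.2.1 - m⟫) = fun p => φ p.2 * (φ p.1 *
          reproducingKernel H p.2.1 p.1.1 - m p.2.1) - (φ p.1 * m p.1.1 - ⟪m, m⟫) := by
      funext p
      rw [hinner, real_inner_comm, hinner]
      simp [kernelSection_apply]
    rw [this]
    have hk : Measurable fun p : (X × ℝ) × (X × ℝ) => reproducingKernel H p.2.1 p.1.1 :=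
      hKmeas.comp (f := fun p : (X × ℝ) × (X × ℝ) => (p.2.1, p.1.1)) (by fun_prop)
    fun_prop
  · filter_upwards [hM] with z hz
    refine (norm_sub_le _ _).trans ?_
    rw [norm_smul]
    gcongr
    · exact (abs_nonneg _).trans hz
    · exact hz
    · exact norm_kernelSection_le hK _
  · intro s
    have hint : ∀ f : H, Integrable (fun z : X × ℝ => φ z * f z.1) μ := by
      intro f
      refine Integrable.of_bound (hφ.mul ((measurable_coe hKmeas f).comp
        measurable_fst)).aestronglyMeasurable (M * (√κ * ‖f‖)) ?_
      filter_upwards [hM] with z hz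
      rw [norm_mul]
      exact mul_le_mul hz (abs_apply_le hK f _) (norm_nonneg _) ((abs_nonneg _).trans hz)
    simp_rw [hinner]
    rw [integral_sub (hint _) (integrable_const _), ← hm, real_inner_comm]
    simp

end Kernel

/-! ### Regularized least squares: the normal equation -/

section Minimizer

variable {H X : Type*} [NormedAddCommGroup H] [InnerProductSpace ℝ H] [RKHS ℝ H X ℝ] {N : ℕ}
  {z : Fin N → X × ℝ} {lam : ℝ}

/-- Expansion of the quadratic risk about a solution of the normal equation: the linear term
vanishes. -/
lemma regularizedRisk_eq_add {f : H}
    (hf : ∀ g : H, (N : ℝ)⁻¹ * ∑ i, (f (z i).1 - (z i).2) * g (z i).1 + lam * ⟪f, g⟫ = 0)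
    (g : H) :
    regularizedRisk z lam g = regularizedRisk z lam f +
      ((N : ℝ)⁻¹ * ∑ i, ((g - f) (z i).1) ^ 2 + lam * ‖g - f‖ ^ 2) := by
  have hd := hf (g - f)
  have hnorm : ‖g‖ ^ 2 = ‖f‖ ^ 2 + 2 * ⟪f, g - f⟫ + ‖g - f‖ ^ 2 := by
    rw [← norm_add_sq_real, add_sub_cancel]
  have hsum : ∑ i, (g (z i).1 - (z i).2) ^ 2 = ∑ i, (f (z i).1 - (z i).2) ^ 2 +
      2 * ∑ i, (f (z i).1 - (z i).2) * (g - f) (z i).1 + ∑ i, ((g - f) (z i).1) ^ 2 := by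
    rw [Finset.mul_sum, ← Finset.sum_add_distrib, ← Finset.sum_add_distrib]
    refine Finset.sum_congr rfl fun i _ => ?_
    simp only [RKHS.coe_sub, Pi.sub_apply]
    ring
  rw [regularizedRisk, regularizedRisk, hnorm, hsum, one_div]
  linear_combination 2 * hd

lemma eq_of_isRLSMinimizer (hlam : 0 < lam) {f g : H}
    (hf : ∀ g : H, (N : ℝ)⁻¹ * ∑ i, (f (z i).1 - (z i).2) * g (z i).1 + lam * ⟪f, g⟫ = 0)
    (hg : IsRLSMinimizer z lam g) : g = f := by
  have h := hg f
  rw [regularizedRisk_eq_add hf g] at h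
  have h1 : 0 ≤ (N : ℝ)⁻¹ * ∑ i, ((g - f) (z i).1) ^ 2 := by positivity
  have h2 : 0 ≤ lam * ‖g - f‖ ^ 2 := by positivity
  have h3 : lam * ‖g - f‖ ^ 2 = 0 := by linarith
  rcases mul_eq_zero.1 h3 with h4 | h4
  · exact absurd h4 hlam.ne'
  · exact sub_eq_zero.1 (norm_eq_zero.1 (pow_eq_zero_iff two_ne_zero |>.1 h4))

lemma isRLSMinimizer_of_normal_equation (hlam : 0 < lam) {f : H}
    (hf : ∀ g : H, (N : ℝ)⁻¹ * ∑ i, (f (z i).1 - (z i).2) * g (z i).1 + lam * ⟪f, g⟫ = 0) :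
    IsRLSMinimizer z lam f := by
  intro g
  rw [regularizedRisk_eq_add hf g]
  exact le_add_of_nonneg_right (by positivity)

variable [CompleteSpace H]

/-- The normal equation, that is, the vanishing at `f` of the derivative of the regularized
empirical risk, has a solution by the Lax–Milgram theorem. -/
lemma exists_normal_equation (z : Fin N → X × ℝ) (hlam : 0 < lam) :
    ∃ f : H, ∀ g : H,
      (N : ℝ)⁻¹ * ∑ i, (f (z i).1 - (z i).2) * g (z i).1 + lam * ⟪f, g⟫ = 0 := by
  let k : Fin N → H := fun i => kernelSection H (z i).1
  let B : H →L[ℝ] H →L[ℝ] ℝ :=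
    (N : ℝ)⁻¹ • ∑ i, (innerSL ℝ (k i)).smulRight (innerSL ℝ (k i)) +
      lam • (isBoundedBilinearMap_inner (𝕜 := ℝ) (E := H)).toContinuousLinearMap
  have hB : ∀ f g : H, B f g =
      (N : ℝ)⁻¹ * ∑ i, f (z i).1 * g (z i).1 + lam * ⟪f, g⟫ := by
    intro f g
    simp [B, k]
  have hco : IsCoercive B := by
    refine ⟨lam, hlam, fun f => ?_⟩
    rw [hB, real_inner_self_eq_norm_mul_norm, mul_assoc]
    refine le_add_of_nonneg_left (mul_nonneg (by positivity)
      (Finset.sum_nonneg fun i _ => mul_self_nonneg _))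
  refine ⟨hco.continuousLinearEquivOfBilin.symm ((N : ℝ)⁻¹ • ∑ i, (z i).2 • k i), fun g => ?_⟩
  have h := hco.continuousLinearEquivOfBilin_apply
    (hco.continuousLinearEquivOfBilin.symm ((N : ℝ)⁻¹ • ∑ i, (z i).2 • k i)) g
  rw [ContinuousLinearEquiv.apply_symm_apply, hB, inner_smul_left, sum_inner] at h
  simp only [inner_smul_left, k, inner_kernelSection, RCLike.conj_to_real] at h
  simp only [sub_mul, Finset.sum_sub_distrib, mul_sub]
  linarith

theorem existsUnique_isRLSMinimizer (z : Fin N → X × ℝ) (hlam : 0 < lam) :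
    ∃! f : H, IsRLSMinimizer z lam f := by
  obtain ⟨f, hf⟩ := exists_normal_equation (H := H) z hlam
  exact ⟨f, isRLSMinimizer_of_normal_equation hlam hf, fun g hg => eq_of_isRLSMinimizer hlam hf hg⟩

lemma IsRLSMinimizer.normal_equation (hlam : 0 < lam) {f : H} (hf : IsRLSMinimizer z lam f)
    (g : H) : (N : ℝ)⁻¹ * ∑ i, (f (z i).1 - (z i).2) * g (z i).1 + lam * ⟪f, g⟫ = 0 := by
  obtain ⟨f', hf'⟩ := exists_normal_equation (H := H) z hlam
  rw [eq_of_isRLSMinimizer hlam hf' hf]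
  exact hf' g

/-- Deterministic error bound. The target `f₀` is compared with an element `m`, thought of as the
weak integral of `h(x) K(·, x)`; the error is controlled by the sample mean of the noise
`y - f₀(x)`, the deviation of the sample mean of `h(x) K(·, x)` from `m`, the distance from `f₀`
to `m` and a bias of order `lam`. -/
theorem IsRLSMinimizer.norm_sub_sq_le {κ : ℝ} (hK : ∀ x : X, reproducingKernel H x x ≤ κ)
    (hN : 0 < N) (hlam : 0 < lam) {f : H} (hf : IsRLSMinimizer z lam f) (f₀ h m : H) :
    ‖f - f₀‖ ^ 2 ≤
      3 * (lam⁻¹ ^ 2 * ‖(N : ℝ)⁻¹ • ∑ i, ((z i).2 - f₀ (z i).1) • kernelSection H (z i).1‖ ^ 2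
        + ‖(N : ℝ)⁻¹ • ∑ i, (h (z i).1 • kernelSection H (z i).1 - m)‖ ^ 2 + ‖f₀ - m‖ ^ 2)
      + lam * (√κ * ‖h‖) ^ 2 / 2 := by
  have hN' : (0 : ℝ) < N := by exact_mod_cast hN
  set d := f - f₀ with hd
  set A := (N : ℝ)⁻¹ • ∑ i, ((z i).2 - f₀ (z i).1) • kernelSection H (z i).1 with hA
  set D := (N : ℝ)⁻¹ • ∑ i, (h (z i).1 • kernelSection H (z i).1 - m) with hD
  have hAd : ⟪A, d⟫ = (N : ℝ)⁻¹ * ∑ i, ((z i).2 - f₀ (z i).1) * d (z i).1 := by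
    rw [hA, inner_smul_left, sum_inner]
    simp [inner_smul_left]
  have hDd : ⟪D, d⟫ = (N : ℝ)⁻¹ * ∑ i, h (z i).1 * d (z i).1 - ⟪m, d⟫ := by
    rw [hD, inner_smul_left, sum_inner]
    simp only [inner_sub_left, inner_smul_left, inner_kernelSection, RCLike.conj_to_real,
      Finset.sum_sub_distrib, Finset.sum_const, Finset.card_univ, Fintype.card_fin, nsmul_eq_mul,
      mul_sub]
    rw [inv_mul_cancel_left₀ hN'.ne']
  have hsplit : ⟪f, d⟫ = ‖d‖ ^ 2 + ⟪f₀ - m, d⟫ + ⟪m, d⟫ := by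
    rw [← real_inner_self_eq_norm_sq, ← inner_add_left, ← inner_add_left, hd]
    congr 1
    abel
  have hnormal := hf.normal_equation hlam d
  have hres : (N : ℝ)⁻¹ * ∑ i, (f (z i).1 - (z i).2) * d (z i).1
      = (N : ℝ)⁻¹ * ∑ i, d (z i).1 ^ 2 - ⟪A, d⟫ := by
    rw [hAd, ← mul_sub, ← Finset.sum_sub_distrib]
    congr 1
    refine Finset.sum_congr rfl fun i _ => ?_
    simp only [hd, RKHS.coe_sub, Pi.sub_apply]
    ring
  -- completing the square absorbs the cross term into the empirical norm of `d`
  have hsq : 0 ≤ (N : ℝ)⁻¹ * ∑ i, d (z i).1 ^ 2 + lam * ((N : ℝ)⁻¹ * ∑ i, h (z i).1 * d (z i).1)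
      + lam ^ 2 / 4 * (√κ * ‖h‖) ^ 2 := by
    have hs : (N : ℝ)⁻¹ * ∑ i, h (z i).1 ^ 2 ≤ (√κ * ‖h‖) ^ 2 := by
      rw [inv_mul_le_iff₀ hN']
      calc ∑ i, h (z i).1 ^ 2 ≤ ∑ _i : Fin N, (√κ * ‖h‖) ^ 2 :=
            Finset.sum_le_sum fun i _ => sq_le_sq' (neg_le_of_abs_le (abs_apply_le hK h _))
              (le_of_abs_le (abs_apply_le hK h _))
        _ = N * (√κ * ‖h‖) ^ 2 := by simp
    have h0 : 0 ≤ (N : ℝ)⁻¹ * ∑ i, (d (z i).1 + lam / 2 * h (z i).1) ^ 2 := by positivity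
    have hexp : (N : ℝ)⁻¹ * ∑ i, (d (z i).1 + lam / 2 * h (z i).1) ^ 2 =
        (N : ℝ)⁻¹ * ∑ i, d (z i).1 ^ 2 + lam * ((N : ℝ)⁻¹ * ∑ i, h (z i).1 * d (z i).1)
          + lam ^ 2 / 4 * ((N : ℝ)⁻¹ * ∑ i, h (z i).1 ^ 2) := by
      simp only [Finset.mul_sum, ← Finset.sum_add_distrib]
      exact Finset.sum_congr rfl fun i _ => by ring
    have := mul_le_mul_of_nonneg_left hs (by positivity : 0 ≤ lam ^ 2 / 4)
    linarith
  have hmain : lam * ‖d‖ ^ 2 ≤ lam *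
      ((lam⁻¹ * ‖A‖ + ‖D‖ + ‖f₀ - m‖) * ‖d‖ + lam / 4 * (√κ * ‖h‖) ^ 2) := by
    have h1 := real_inner_le_norm A d
    have h2 := mul_le_mul_of_nonneg_left (real_inner_le_norm D d) hlam.le
    have h3 := mul_le_mul_of_nonneg_left
      ((neg_le_abs _).trans (abs_real_inner_le_norm (f₀ - m) d)) hlam.le
    have h4 : lam * ((lam⁻¹ * ‖A‖ + ‖D‖ + ‖f₀ - m‖) * ‖d‖ + lam / 4 * (√κ * ‖h‖) ^ 2) =
        ‖A‖ * ‖d‖ + lam * (‖D‖ * ‖d‖) + lam * (‖f₀ - m‖ * ‖d‖)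
          + lam ^ 2 / 4 * (√κ * ‖h‖) ^ 2 := by
      field_simp
    rw [h4]
    rw [hres, hsplit] at hnormal
    rw [hDd] at h2
    linarith
  have hmain' := le_of_mul_le_mul_left hmain hlam
  have e1 := sq_nonneg (lam⁻¹ * ‖A‖ - ‖D‖)
  have e2 := sq_nonneg (lam⁻¹ * ‖A‖ - ‖f₀ - m‖)
  have e3 := sq_nonneg (‖D‖ - ‖f₀ - m‖)
  have e4 := sq_nonneg (lam⁻¹ * ‖A‖ + ‖D‖ + ‖f₀ - m‖ - ‖d‖)
  rw [← mul_pow]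
  linarith

end Minimizer

/-! ### The regression function -/

section Regression

variable {H X : Type*} [MeasurableSpace X] [NormedAddCommGroup H] [InnerProductSpace ℝ H]
  [RKHS ℝ H X ℝ]

/-- The noise `y - E(y | x)` is orthogonal to bounded measurable functions of `x`. -/
lemma integral_noise_mul_eq_zero {μ : Measure (X × ℝ)} [IsProbabilityMeasure μ] {R : ℝ}
    (hR : ∀ᵐ z ∂μ, |z.2| ≤ R) {f g : X → ℝ} (hf : Measurable f)
    (hfreg : ∀ᵐ x ∂μ.fst, f x = regressionFunction μ x) {F : ℝ} (hF : ∀ x, |f x| ≤ F)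
    (hg : Measurable g) {G : ℝ} (hG : ∀ x, |g x| ≤ G) :
    ∫ z, (z.2 - f z.1) * g z.1 ∂μ = 0 := by
  have h1 : Integrable (fun z : X × ℝ => z.2 * g z.1) μ := by
    refine Integrable.of_bound (by fun_prop) (R * G) ?_
    filter_upwards [hR] with z hz
    rw [norm_mul]
    exact mul_le_mul hz (hG _) (norm_nonneg _) ((abs_nonneg _).trans hz)
  have h2 : Integrable (fun z : X × ℝ => f z.1 * g z.1) μ := by
    refine Integrable.of_bound (by fun_prop) (F * G) (ae_of_all _ fun z => ?_)
    rw [norm_mul]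
    exact mul_le_mul (hF _) (hG _) (norm_nonneg _) ((abs_nonneg _).trans (hF z.1))
  simp_rw [sub_mul]
  rw [integral_sub h1 h2, ← Measure.integral_condKernel h1, ← Measure.integral_condKernel h2,
    sub_eq_zero]
  refine integral_congr_ae ?_
  filter_upwards [hfreg] with x hx
  simp only [integral_mul_const, integral_const, probReal_univ, one_smul, hx,
    regressionFunction]

/-- An element of least norm among those with prescribed values almost everywhere is orthogonal
to the elements vanishing almost everywhere. -/
lemma inner_eq_zero_of_least_norm {ν : Measure X} {r : X → ℝ} {f₀ : H}
    (hf₀ : ∀ᵐ x ∂ν, f₀ x = r x) (hmin : ∀ g : H, (∀ᵐ x ∂ν, g x = r x) → ‖f₀‖ ≤ ‖g‖) {g : H}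
    (hg : ∀ᵐ x ∂ν, g x = 0) : ⟪f₀, g⟫ = 0 := by
  by_contra hne
  have hg0 : 0 < ‖g‖ ^ 2 := by
    have : g ≠ 0 := by rintro rfl; simp at hne
    positivity
  set t := ⟪f₀, g⟫ / ‖g‖ ^ 2 with ht
  have hle := hmin (f₀ - t • g) (by
    filter_upwards [hf₀, hg] with x hx hx'
    simp [hx, hx'])
  have hsq := pow_le_pow_left₀ (norm_nonneg _) hle 2
  rw [norm_sub_sq_real, inner_smul_right, norm_smul, mul_pow, Real.norm_eq_abs, sq_abs] at hsq
  have htg : t * ‖g‖ ^ 2 = ⟪f₀, g⟫ := div_mul_cancel₀ _ hg0.ne'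
  have : t ^ 2 * ‖g‖ ^ 2 = t * ⟪f₀, g⟫ := by rw [← htg]; ring
  have hpos : 0 < t * ⟪f₀, g⟫ := by
    rw [ht, div_mul_eq_mul_div]
    exact div_pos (mul_self_pos.2 hne) hg0
  linarith

variable [CompleteSpace H]

/-- An element of `H` orthogonal to all elements vanishing almost everywhere lies in the closure
of the range of the integral operator `h ↦ ∫ h(x) K(·, x) dν(x)`. -/
lemma exists_weak_integral_near {ν : Measure X} [IsProbabilityMeasure ν]
    (hKmeas : Measurable fun p : X × X => reproducingKernel H p.1 p.2) {κ : ℝ}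
    (hK : ∀ x : X, reproducingKernel H x x ≤ κ) {f₀ : H}
    (hf₀ : ∀ g : H, (∀ᵐ x ∂ν, g x = 0) → ⟪f₀, g⟫ = 0) {ε : ℝ} (hε : 0 < ε) :
    ∃ h m : H, (∀ f : H, ⟪m, f⟫ = ∫ x, h x * f x ∂ν) ∧ ‖f₀ - m‖ < ε := by
  have hint : ∀ f g : H, Integrable (fun x => f x * g x) ν := by
    intro f g
    refine Integrable.of_bound ((measurable_coe hKmeas f).mul
      (measurable_coe hKmeas g)).aestronglyMeasurable ((√κ * ‖f‖) * (√κ * ‖g‖))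
      (ae_of_all _ fun x => ?_)
    rw [norm_mul]
    exact mul_le_mul (abs_apply_le hK f x) (abs_apply_le hK g x) (norm_nonneg _)
      ((abs_nonneg _).trans (abs_apply_le hK f x))
  let W : Submodule ℝ H :=
    { carrier := {m | ∃ h : H, ∀ f : H, ⟪m, f⟫ = ∫ x, h x * f x ∂ν}
      zero_mem' := ⟨0, fun f => by simp⟩
      add_mem' := by
        rintro a b ⟨h, hh⟩ ⟨h', hh'⟩
        refine ⟨h + h', fun f => ?_⟩
        rw [inner_add_left, hh, hh', ← integral_add (hint h f) (hint h' f)]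
        simp [add_mul]
      smul_mem' := by
        rintro c a ⟨h, hh⟩
        refine ⟨c • h, fun f => ?_⟩
        rw [inner_smul_left, hh, RCLike.conj_to_real, ← integral_const_mul]
        simp [mul_assoc] }
  have hmem : f₀ ∈ W.topologicalClosure := by
    rw [← Submodule.orthogonal_orthogonal_eq_closure, Submodule.mem_orthogonal']
    intro g hg
    refine hf₀ g ?_
    obtain ⟨m, hm⟩ := exists_weak_integral hKmeas hK (μ := ν) (measurable_coe hKmeas g)
      (ae_of_all _ fun x => abs_apply_le hK g x)
    have h0 : ∫ x, g x * g x ∂ν = 0 := by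
      rw [← hm g]
      exact (Submodule.mem_orthogonal W g).1 hg m ⟨g, hm⟩
    rw [integral_eq_zero_iff_of_nonneg (fun x => mul_self_nonneg (g x)) (hint g g)] at h0
    filter_upwards [h0] with x hx
    exact mul_self_eq_zero.1 hx
  obtain ⟨m, ⟨h, hh⟩, hdist⟩ := Metric.mem_closure_iff.1 hmem ε hε
  exact ⟨h, m, hh, by rwa [← dist_eq_norm]⟩

end Regression

/-! ### Convergence in probability -/

lemma integral_three_mul_add {Ω : Type*} [MeasurableSpace Ω] {P : Measure Ω}
    [IsProbabilityMeasure P] {u v : Ω → ℝ} (hu : Integrable u P) (hv : Integrable v P)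
    (a b c : ℝ) :
    Integrable (fun ω => 3 * (a * u ω + v ω + b) + c) P ∧
      ∫ ω, (3 * (a * u ω + v ω + b) + c) ∂P = 3 * (a * ∫ ω, u ω ∂P + ∫ ω, v ω ∂P + b) + c := by
  have h1 : Integrable (fun ω => a * u ω) P := hu.const_mul a
  have h2 : Integrable (fun ω => a * u ω + v ω) P := h1.add hv
  have h3 : Integrable (fun ω => a * u ω + v ω + b) P := h2.add (integrable_const b)
  have h4 : Integrable (fun ω => 3 * (a * u ω + v ω + b)) P := h3.const_mul 3
  refine ⟨h4.add (integrable_const c), ?_⟩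
  rw [integral_add h4 (integrable_const c), integral_const_mul,
    integral_add h2 (integrable_const b), integral_add h1 hv, integral_const_mul]
  simp

/-- Markov's inequality for a possibly non-measurable sequence `d`: it suffices that, for every
`η > 0`, the squares `d²` have integrable majorants with expectations eventually below `η`. -/
lemma tendstoInMeasure_zero_of_sq_le {Ω : Type*} [MeasurableSpace Ω] {P : Measure Ω}
    [IsProbabilityMeasure P] {d : ℕ → Ω → ℝ}
    (h : ∀ η > 0, ∃ G : ℕ → Ω → ℝ, ∀ᶠ N in atTop,
      (∀ ω, d N ω ^ 2 ≤ G N ω) ∧ Integrable (G N) P ∧ ∫ ω, G N ω ∂P ≤ η) :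
    TendstoInMeasure P d atTop (fun _ => (0 : ℝ)) := by
  rw [tendstoInMeasure_iff_measureReal_norm]
  intro ε hε
  rw [Metric.tendsto_nhds]
  intro η hη
  obtain ⟨G, hG⟩ := h (ε ^ 2 * (η / 2)) (by positivity)
  filter_upwards [hG] with N ⟨hd, hint, hle⟩
  have h1 : P.real {ω | ε ≤ ‖d N ω - 0‖} ≤ P.real {ω | ε ^ 2 ≤ G N ω} := by
    refine measureReal_mono fun ω hω => ?_
    simp only [sub_zero, Set.mem_ofPred_eq, Real.norm_eq_abs] at hω
    refine le_trans ?_ (hd ω)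
    rw [← sq_abs (d N ω)]
    exact pow_le_pow_left₀ hε.le hω 2
  have h2 := mul_meas_ge_le_integral_of_nonneg
    (ae_of_all P fun ω => (sq_nonneg _).trans (hd ω)) hint (ε ^ 2)
  have h3 : P.real {ω | ε ^ 2 ≤ G N ω} ≤ η / 2 :=
    le_of_mul_le_mul_left (h2.trans hle) (by positivity)
  rw [Real.dist_eq, sub_zero, abs_of_nonneg measureReal_nonneg]
  linarith

end

theorem theorem1 {n : ℕ} (X : Set (EuclideanSpace ℝ (Fin n))) (hX : Bornology.IsBounded X)
    (Y : Set ℝ) (hY : Bornology.IsBounded Y)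
    -- the distribution of a pair `(x, y)`
    (μ : Measure (X × ℝ)) [IsProbabilityMeasure μ] (hμY : ∀ᵐ z ∂μ, z.2 ∈ Y)
    -- the RKHS, with a measurable and bounded kernel
    {H : Type*} [NormedAddCommGroup H] [InnerProductSpace ℝ H] [CompleteSpace H]
    [RKHS ℝ H X ℝ]
    (hKmeas : Measurable fun p : X × X => reproducingKernel H p.1 p.2)
    (κ : ℝ) (hKbdd : ∀ x : X, reproducingKernel H x x ≤ κ)
    -- `fE` is the version of `E(y | x)` in `H`; of least norm, if there are several
    (fE : H) (hfE : ∀ᵐ x ∂μ.fst, fE x = regressionFunction μ x)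
    (hfEmin : ∀ g : H, (∀ᵐ x ∂μ.fst, g x = regressionFunction μ x) → ‖fE‖ ≤ ‖g‖)
    -- the i.i.d. sample
    {Ω : Type*} [MeasurableSpace Ω] (P : Measure Ω) [IsProbabilityMeasure P]
    (Z : ℕ → Ω → X × ℝ) (hZlaw : ∀ i, HasLaw (Z i) μ P) (hZindep : iIndepFun Z P)
    -- the regularization parameters
    (lam : ℕ → ℝ) (hlampos : ∀ N, 0 < N → 0 < lam N)
    (hlam : Tendsto lam atTop (𝓝 0))
    (hNlam : Tendsto (fun N : ℕ => (N : ℝ) * lam N ^ 3) atTop atTop) :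
    (∀ N : ℕ, 0 < N → ∀ z : Fin N → X × ℝ, ∃! f : H, IsRLSMinimizer z (lam N) f) ∧
    ∀ f : ℕ → Ω → H,
      (∀ N : ℕ, 0 < N → ∀ ω, IsRLSMinimizer (fun i : Fin N => Z i ω) (lam N) (f N ω)) →
      TendstoInMeasure P (fun N ω => ‖f N ω - fE‖) atTop (fun _ => (0 : ℝ)) := by
  refine ⟨fun N hN z => existsUnique_isRLSMinimizer z (hlampos N hN), fun f hf => ?_⟩
  obtain ⟨R, hYR⟩ := hY.exists_norm_le
  have hR : ∀ᵐ z ∂μ, |z.2| ≤ R := hμY.mono fun z hz => hYR _ hz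
  have hmE : Measurable (fE : X → ℝ) := measurable_coe hKmeas fE
  -- the noise `(y - fE(x)) K(·, x)` is weakly centred
  have hnoise : ∀ g : H, inner ℝ (0 : H) g = ∫ z, (z.2 - fE z.1) * g z.1 ∂μ := fun g => by
    rw [inner_zero_left, integral_noise_mul_eq_zero hR hmE hfE (abs_apply_le hKbdd fE)
      (measurable_coe hKmeas g) (abs_apply_le hKbdd g)]
  obtain ⟨C₁, hC₁⟩ := exists_sample_mean_bound hKmeas hKbdd
    (φ := fun z : X × ℝ => z.2 - fE z.1) (by fun_prop) (M := R + √κ * ‖fE‖)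
    (hR.mono fun z hz => (abs_sub _ _).trans (add_le_add hz (abs_apply_le hKbdd fE _)))
    hnoise hZlaw hZindep
  simp only [sub_zero] at hC₁
  -- `lam N ≤ 1` eventually, so `N * lam N ^ 2` dominates `N * lam N ^ 3`
  have hNlam2 : Tendsto (fun N : ℕ => (N : ℝ) * lam N ^ 2) atTop atTop := by
    refine tendsto_atTop_mono' _ ?_ hNlam
    filter_upwards [hlam.eventually_le_const one_pos, eventually_gt_atTop 0] with N h1 hN
    have := (hlampos N hN).le
    exact mul_le_mul_of_nonneg_left (pow_le_pow_of_le_one this h1 (by norm_num)) (by positivity)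
  refine tendstoInMeasure_zero_of_sq_le fun η hη => ?_
  have hδ : 0 < √(η / 6) := Real.sqrt_pos.2 (by positivity)
  obtain ⟨h, m, hm, hclose⟩ := exists_weak_integral_near (ν := μ.fst) hKmeas hKbdd
    (fun g hg => inner_eq_zero_of_least_norm hfE hfEmin hg) hδ
  have hclose2 : ‖fE - m‖ ^ 2 ≤ η / 6 := by
    have := pow_le_pow_left₀ (norm_nonneg _) hclose.le 2
    rwa [Real.sq_sqrt (by positivity)] at this
  have hmh : Measurable (h : X → ℝ) := measurable_coe hKmeas h
  have hm' : ∀ g : H, inner ℝ m g = ∫ z, h z.1 * g z.1 ∂μ := fun g => by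
    rw [hm g, Measure.fst, integral_map (f := fun x => h x * g x) (by fun_prop)
      (hmh.mul (measurable_coe hKmeas g)).aestronglyMeasurable]
  obtain ⟨C₂, hC₂⟩ := exists_sample_mean_bound hKmeas hKbdd
    (φ := fun z : X × ℝ => h z.1) (by fun_prop)
    (ae_of_all μ fun z => abs_apply_le hKbdd h z.1) hm' hZlaw hZindep
  have hlim : Tendsto (fun N : ℕ => 3 * (C₁ * ((N : ℝ) * lam N ^ 2)⁻¹ + C₂ * (N : ℝ)⁻¹ + η / 6)
      + lam N * ((√κ * ‖h‖) ^ 2 / 2)) atTop (𝓝 (η / 2)) := by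
    have h1 : Tendsto (fun N : ℕ => C₁ * ((N : ℝ) * lam N ^ 2)⁻¹) atTop (𝓝 (C₁ * 0)) :=
      hNlam2.inv_tendsto_atTop.const_mul C₁
    have h2 : Tendsto (fun N : ℕ => C₂ * (N : ℝ)⁻¹) atTop (𝓝 (C₂ * 0)) :=
      (tendsto_inv_atTop_zero.comp tendsto_natCast_atTop_atTop).const_mul C₂
    have h3 := (((h1.add h2).add_const (η / 6)).const_mul 3).add
      (hlam.mul_const ((√κ * ‖h‖) ^ 2 / 2))
    have h4 : 3 * (C₁ * 0 + C₂ * 0 + η / 6) + 0 * ((√κ * ‖h‖) ^ 2 / 2) = η / 2 := by ring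
    rwa [h4] at h3
  refine ⟨fun N ω => 3 * (((lam N)⁻¹) ^ 2 * ‖(N : ℝ)⁻¹ • ∑ i : Fin N,
        ((Z i ω).2 - fE (Z i ω).1) • kernelSection H (Z i ω).1‖ ^ 2
      + ‖(N : ℝ)⁻¹ • ∑ i : Fin N, (h (Z i ω).1 • kernelSection H (Z i ω).1 - m)‖ ^ 2
      + ‖fE - m‖ ^ 2) + lam N * (√κ * ‖h‖) ^ 2 / 2, ?_⟩
  filter_upwards [hlim.eventually_le_const (half_lt_self hη), eventually_gt_atTop 0] with N hle hN
  have hlamN := hlampos N hN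
  obtain ⟨i1, b1⟩ := hC₁ N hN
  obtain ⟨i2, b2⟩ := hC₂ N hN
  obtain ⟨hint, heq⟩ := integral_three_mul_add i1 i2 ((lam N)⁻¹ ^ 2) (‖fE - m‖ ^ 2)
    (lam N * (√κ * ‖h‖) ^ 2 / 2)
  refine ⟨fun ω => (hf N hN ω).norm_sub_sq_le hKbdd hN hlamN fE h m, hint, heq.trans_le ?_⟩
  have b1' := mul_le_mul_of_nonneg_left b1 (by positivity : 0 ≤ (lam N)⁻¹ ^ 2)
  have e1 : (lam N)⁻¹ ^ 2 * (C₁ / N) = C₁ * ((N : ℝ) * lam N ^ 2)⁻¹ := by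
    rw [mul_inv, inv_pow, div_eq_mul_inv]; ring
  rw [e1] at b1'
  rw [div_eq_mul_inv] at b2
  linarith
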